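/- Let $n\geq 1$ and let $\mathbb F_n^+$ be the unital free semigroup with generators $g_1,\dots,g_n$ and identity $g_0$; let $|\alpha|$ be the length of a word $\alpha$. Let $F^2(H_n)$ be the full Fock space of an $n$-dimensional complex Hilbert space $H_n$, with its orthonormal basis $\{e_\alpha\}_{\alpha\in\mathbb F_n^+}$ (that is, $\ell^2(\mathbb F_n^+)$). Let $\boldsymbol\mu=\{\mu_\beta\}_{|\beta|\ge 1}$ be strictly positive real numbers. Put $\boldsymbol\mu(g_0,g_0)=1$ and $\boldsymbol\mu(\beta,g_0)=\mu_{g_{i_1}\cdots g_{i_p}}\,\mu_{g_{i_2}\cdots g_{i_p}}\cdots\mu_{g_{i_p}}$ for $\beta=g_{i_1}\cdots g_{i_p}$, and assume that for every $i\in\{1,\dots,n\}$ $$\sup_{\alpha\in\mathbb F_n^+}\mu_{g_i\alpha}<\infty\qquad\text{and}\qquad \sup_{\alpha\in\mathbb F_n^+}\frac{\boldsymbol\mu(\alpha g_i,g_0)}{\boldsymbol\mu(\alpha,g_0)}<\infty .$$ Let $W_1,\dots,W_n$ be the bounded operators on $F^2(H_n)$ with $W_ie_\alpha=\mu_{g_i\alpha}e_{g_i\alpha}$.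 For $\lambda\in\mathbb C^n$ put $\lambda_{g_0}=1$ and $\lambda_\alpha=\lambda_{i_1}\cdots\lambda_{i_p}$ if $\alpha=g_{i_1}\cdots g_{i_p}$. Let $\mathcal D(\boldsymbol\mu)$ be the set of all $\lambda\in\mathbb C^n$ for which there is $C>0$ such that $$\Big|\sum_\alpha c_\alpha\lambda_\alpha\Big|\le C\Big(\sum_\alpha\boldsymbol\mu(\alpha,g_0)^2|c_\alpha|^2\Big)^{1/2}$$ for all finitely supported families $(c_\alpha)_{\alpha\in\mathbb F_n^+}$ of complex numbers, and assume that $\mathcal D(\boldsymbol\mu)$ contains a neighborhood of the origin. For $\mathbf k\in\mathbb N_0^n$ let $\Lambda_{\mathbf k}$ be the finite set of all $\alpha\in\mathbb F_n^+$ with $\lambda_\alpha=\lambda^{\mathbf k}$ for all $\lambda\in\mathbb C^n$, and put $$\omega_{\mathbf k}=\sum_{\alpha\in\Lambda_{\mathbf k}}\frac1{\boldsymbol\mu(\alpha,g_0)^2},\qquad y^{(\mathbf k)}=\frac1{\omega_{\mathbf k}}\sum_{\alpha\in\Lambda_{\mathbf k}}\frac1{\boldsymbol\mu(\alpha,g_0)}\,e_\alpha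 .$$ Let $F_s^2(\boldsymbol\mu)\subset F^2(H_n)$ be the closed linear span of $\{y^{(\mathbf k)}:\mathbf k\in\mathbb N_0^n\}$, let $B_i=P_{F_s^2(\boldsymbol\mu)}W_i|_{F_s^2(\boldsymbol\mu)}$ for $i=1,\dots,n$, and let $F_s^\infty(\boldsymbol\mu)$ be the $w^*$-closed (non-self-adjoint) subalgebra of $B(F_s^2(\boldsymbol\mu))$ generated by $B_1,\dots,B_n$ and the identity. For a set $\mathcal U$ of bounded operators on a Hilbert space $\mathcal H$ let $\operatorname{Lat}\mathcal U$ be the set of all closed subspaces of $\mathcal H$ that are invariant under every $A\in\mathcal U$; for a set $\mathcal S$ of closed subspaces let $\operatorname{Alg}\mathcal S$ be the set of all $A\in B(\mathcal H)$ that leave every member of $\mathcal S$ invariant. Then $F_s^\infty(\boldsymbol\mu)$ is reflexive, that is, $$F_s^\infty(\boldsymbol\mu)=\operatorname{Alg}\operatorname{Lat}F_s^\infty(\boldsymbol\mu).$$ -/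

import Mathlib

open scoped Topology

namespace WeightedFock

/-! ### The free semigroup, weights and the full Fock space

The unital free semigroup on `g_1, …, g_n` is `FreeMonoid (Fin n)`; its identity `g_0` is `1`. -/

/-- The product `μ(β, g_0) = μ_{g_{i_1} ⋯ g_{i_p}} μ_{g_{i_2} ⋯ g_{i_p}} ⋯ μ_{g_{i_p}}` of the
weights of all nonempty suffixes of a word `β = g_{i_1} ⋯ g_{i_p}`, the word being given by its
list of letters. -/
def weightProdList {n : ℕ} (μ : FreeMonoid (Fin n) → ℝ) : List (Fin n) → ℝ
  | [] => 1
  | i :: l => μ (FreeMonoid.ofList (i :: l)) * weightProdList μ l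

/-- The number `μ(β, g_0)`; it is `1` for `β = g_0`. -/
def weightProd {n : ℕ} (μ : FreeMonoid (Fin n) → ℝ) (β : FreeMonoid (Fin n)) : ℝ :=
  weightProdList μ (FreeMonoid.toList β)

/-- A weight sequence `{μ_β}_{|β| ≥ 1}` of strictly positive numbers for which the weighted left
and the weighted right multi-shifts are bounded. The value of `μ` at the identity is irrelevant:
it is not used anywhere. -/
structure IsWeightSequence {n : ℕ} (μ : FreeMonoid (Fin n) → ℝ) : Prop where
  pos : ∀ β, β ≠ 1 → 0 < μ β
  bddAbove_left : ∀ i, BddAbove (Set.range fun α => μ (FreeMonoid.of i * α))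
  bddAbove_right : ∀ i, BddAbove (Set.range fun α =>
    weightProd μ (α * FreeMonoid.of i) / weightProd μ α)

/-- The full Fock space `F²(H_n)`, realized as `ℓ²` over the free semigroup: the orthonormal basis
`e_α = e_{i_1} ⊗ ⋯ ⊗ e_{i_k}` is the standard basis of `ℓ²`. -/
abbrev FockSpace (n : ℕ) : Type := lp (fun _ : FreeMonoid (Fin n) => ℂ) 2

instance freeMonoidDecidableEq {n : ℕ} : DecidableEq (FreeMonoid (Fin n)) :=
  inferInstanceAs (DecidableEq (List (Fin n)))

/-- The basis vector `e_α`. -/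
noncomputable def fockBasis {n : ℕ} (α : FreeMonoid (Fin n)) : FockSpace n :=
  lp.single 2 α (1 : ℂ)

theorem of_mul_injective {n : ℕ} (i : Fin n) :
    Function.Injective fun α : FreeMonoid (Fin n) => FreeMonoid.of i * α :=
  mul_right_injective _

/-- The coordinates of `W_i f`: the coordinate at `g_i α` is `μ_{g_i α} f_α`, and the coordinate
at a word that does not begin with `g_i` is `0`. -/
noncomputable def shiftFun {n : ℕ} (μ : FreeMonoid (Fin n) → ℝ) (i : Fin n)
    (f : FreeMonoid (Fin n) → ℂ) : FreeMonoid (Fin n) → ℂ :=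
  Function.extend (fun α => FreeMonoid.of i * α) (fun α => (μ (FreeMonoid.of i * α) : ℂ) * f α) 0

theorem shiftFun_of_mul {n : ℕ} (μ : FreeMonoid (Fin n) → ℝ) (i : Fin n)
    (f : FreeMonoid (Fin n) → ℂ) (α : FreeMonoid (Fin n)) :
    shiftFun μ i f (FreeMonoid.of i * α) = (μ (FreeMonoid.of i * α) : ℂ) * f α :=
  (of_mul_injective i).extend_apply _ _ α

theorem shiftFun_of_forall_ne {n : ℕ} (μ : FreeMonoid (Fin n) → ℝ) (i : Fin n)
    (f : FreeMonoid (Fin n) → ℂ) (β : FreeMonoid (Fin n))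
    (hβ : ∀ α, FreeMonoid.of i * α ≠ β) : shiftFun μ i f β = 0 :=
  Function.extend_apply' _ _ _ (by rintro ⟨α, h⟩; exact hβ α h)

theorem norm_sq_shiftFun {n : ℕ} (μ : FreeMonoid (Fin n) → ℝ) (i : Fin n)
    (f : FreeMonoid (Fin n) → ℂ) :
    (fun β => ‖shiftFun μ i f β‖ ^ 2) = Function.extend (fun α => FreeMonoid.of i * α)
      (fun α => ‖(μ (FreeMonoid.of i * α) : ℂ) * f α‖ ^ 2) 0 := by
  funext β
  by_cases h : ∃ α, FreeMonoid.of i * α = β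
  · obtain ⟨α, rfl⟩ := h
    have h := (of_mul_injective i).extend_apply
      (fun α => ‖(μ (FreeMonoid.of i * α) : ℂ) * f α‖ ^ 2) 0 α
    simp only [shiftFun_of_mul]
    exact h.symm
  · rw [shiftFun_of_forall_ne μ i f β (fun α hα => h ⟨α, hα⟩), Function.extend_apply' _ _ _ h]
    simp

theorem summable_norm_sq {n : ℕ} (f : FockSpace n) : Summable fun α => ‖f α‖ ^ 2 := by
  have h := (lp.hasSum_norm (p := 2) (by norm_num) f).summable
  simpa using h

theorem norm_sq_eq_tsum {n : ℕ} (f : FockSpace n) : ‖f‖ ^ 2 = ∑' α, ‖f α‖ ^ 2 := by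
  have h := lp.norm_rpow_eq_tsum (p := 2) (by norm_num) f
  simpa using h

theorem IsWeightSequence.exists_bound {n : ℕ} {μ : FreeMonoid (Fin n) → ℝ}
    (hμ : IsWeightSequence μ) (i : Fin n) :
    ∃ C : ℝ, 0 ≤ C ∧ ∀ (f : FreeMonoid (Fin n) → ℂ) (α : FreeMonoid (Fin n)),
      ‖(μ (FreeMonoid.of i * α) : ℂ) * f α‖ ^ 2 ≤ C ^ 2 * ‖f α‖ ^ 2 := by
  obtain ⟨C, hC⟩ := hμ.bddAbove_left i
  have hpos : ∀ α, 0 < μ (FreeMonoid.of i * α) := fun α =>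
    hμ.pos _ fun h => by simpa using congrArg FreeMonoid.length h
  have hle : ∀ α, μ (FreeMonoid.of i * α) ≤ C := fun α => hC ⟨α, rfl⟩
  refine ⟨C, (hpos 1).le.trans (hle 1), fun f α => ?_⟩
  rw [norm_mul, mul_pow, Complex.norm_real, Real.norm_of_nonneg (hpos α).le]
  have := pow_le_pow_left₀ (hpos α).le (hle α) 2
  gcongr

theorem IsWeightSequence.summable_shift {n : ℕ} {μ : FreeMonoid (Fin n) → ℝ}
    (hμ : IsWeightSequence μ) (i : Fin n) (f : FockSpace n) :
    Summable fun α => ‖(μ (FreeMonoid.of i * α) : ℂ) * f α‖ ^ 2 := by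
  obtain ⟨C, -, hC⟩ := hμ.exists_bound i
  exact Summable.of_nonneg_of_le (fun _ => by positivity) (hC f)
    ((summable_norm_sq f).mul_left _)

theorem IsWeightSequence.memℓp_shiftFun {n : ℕ} {μ : FreeMonoid (Fin n) → ℝ}
    (hμ : IsWeightSequence μ) (i : Fin n) (f : FockSpace n) :
    Memℓp (shiftFun μ i f) 2 := by
  refine memℓp_gen ?_
  have h : Summable fun β => ‖shiftFun μ i f β‖ ^ 2 := by
    rw [norm_sq_shiftFun]
    exact (summable_extend_zero (of_mul_injective i)).2 (hμ.summable_shift i f)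
  simpa using h

/-- The weighted left creation operator `W_i` on the full Fock space, `W_i e_α = μ_{g_i α}
e_{g_i α}`. -/
noncomputable def multiShift {n : ℕ} (μ : FreeMonoid (Fin n) → ℝ) (hμ : IsWeightSequence μ)
    (i : Fin n) : FockSpace n →L[ℂ] FockSpace n :=
  LinearMap.mkContinuousOfExistsBound
    { toFun := fun f => ⟨shiftFun μ i f, hμ.memℓp_shiftFun i f⟩
      map_add' := fun f g => by
        ext β
        change shiftFun μ i (f + g : FockSpace n) β = shiftFun μ i f β + shiftFun μ i g β
        by_cases h : ∃ α, FreeMonoid.of i * α = β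
        · obtain ⟨α, rfl⟩ := h
          simp only [shiftFun_of_mul, lp.coeFn_add, Pi.add_apply, mul_add]
        · have h' : ∀ α, FreeMonoid.of i * α ≠ β := fun α hα => h ⟨α, hα⟩
          rw [shiftFun_of_forall_ne μ i _ β h', shiftFun_of_forall_ne μ i _ β h',
            shiftFun_of_forall_ne μ i _ β h', add_zero]
      map_smul' := fun c f => by
        ext β
        change shiftFun μ i (c • f : FockSpace n) β = c * shiftFun μ i f β
        by_cases h : ∃ α, FreeMonoid.of i * α = β
        · obtain ⟨α, rfl⟩ := h
          simp only [shiftFun_of_mul, lp.coeFn_smul, Pi.smul_apply, smul_eq_mul]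
          ring
        · have h' : ∀ α, FreeMonoid.of i * α ≠ β := fun α hα => h ⟨α, hα⟩
          rw [shiftFun_of_forall_ne μ i _ β h', shiftFun_of_forall_ne μ i _ β h', mul_zero] }
    (by
      obtain ⟨C, hC0, hC⟩ := hμ.exists_bound i
      refine ⟨C, fun f => ?_⟩
      refine le_of_sq_le_sq ?_ (by positivity)
      rw [norm_sq_eq_tsum, mul_pow, norm_sq_eq_tsum, ← tsum_mul_left]
      change ∑' β, ‖shiftFun μ i f β‖ ^ 2 ≤ _
      rw [norm_sq_shiftFun, tsum_extend_zero (of_mul_injective i)]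
      exact (hμ.summable_shift i f).tsum_le_tsum (hC f) ((summable_norm_sq f).mul_left _))

/-- The action of the multi-shift on the basis. -/
theorem multiShift_fockBasis {n : ℕ} (μ : FreeMonoid (Fin n) → ℝ) (hμ : IsWeightSequence μ)
    (i : Fin n) (α : FreeMonoid (Fin n)) :
    multiShift μ hμ i (fockBasis α) =
      (μ (FreeMonoid.of i * α) : ℂ) • fockBasis (FreeMonoid.of i * α) := by
  ext β
  change shiftFun μ i (fockBasis α) β = _
  rw [lp.coeFn_smul, Pi.smul_apply, smul_eq_mul]
  unfold fockBasis
  by_cases h : ∃ γ, FreeMonoid.of i * γ = β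
  · obtain ⟨γ, rfl⟩ := h
    rw [shiftFun_of_mul]
    by_cases hγ : γ = α
    · subst hγ
      simp
    · rw [lp.single_apply_ne _ _ _ hγ,
        lp.single_apply_ne _ _ _ fun h => hγ (of_mul_injective i h)]
      simp
  · have h' : ∀ γ, FreeMonoid.of i * γ ≠ β := fun γ hγ => h ⟨γ, hγ⟩
    rw [shiftFun_of_forall_ne μ i _ β h', lp.single_apply_ne _ _ _ (h' α).symm, mul_zero]

/-! ### Bounded point evaluations -/

/-- The set `𝒟(μ)` of all `ζ ∈ ℂⁿ` for which evaluation at `ζ` of polynomials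
`p = ∑ c_α Z_α` in noncommuting indeterminates, `p(ζ) = ∑ c_α ζ_α`, is bounded with respect to the
norm `‖p‖_μ = (∑ μ(α, g_0)² |c_α|²)^{1/2}`. A polynomial is given by its coefficients. -/
def pointEvaluations {n : ℕ} (μ : FreeMonoid (Fin n) → ℝ) : Set (Fin n → ℂ) :=
  {ζ | ∃ C : ℝ, 0 < C ∧ ∀ p : FreeMonoid (Fin n) →₀ ℂ,
    ‖p.sum fun α c => c * FreeMonoid.lift ζ α‖ ≤
      C * √(p.sum fun α c => weightProd μ α ^ 2 * ‖c‖ ^ 2)}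

/-! ### The symmetric weighted Fock space -/

/-- The set `Λ_k` of all words `α` with `ζ_α = ζ^k` for all `ζ ∈ ℂⁿ`. -/
def wordsOfType {n : ℕ} (k : Fin n → ℕ) : Set (FreeMonoid (Fin n)) :=
  {α | ∀ ζ : Fin n → ℂ, FreeMonoid.lift ζ α = ∏ i, ζ i ^ k i}

theorem wordsOfType_finite {n : ℕ} (k : Fin n → ℕ) : (wordsOfType k).Finite := by
  refine (List.finite_length_eq (Fin n) (∑ i, k i)).subset fun (α : FreeMonoid (Fin n)) hα => ?_
  have h := hα fun _ => 2
  rw [FreeMonoid.lift_apply, List.map_const', List.prod_replicate, Finset.prod_pow_eq_pow_sum] at h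
  have h2 : (2 : ℕ) ^ (FreeMonoid.toList α).length = 2 ^ ∑ i, k i := by exact_mod_cast h
  exact Nat.pow_right_injective le_rfl h2

/-- `ω_k = ∑_{α ∈ Λ_k} 1 / μ(α, g_0)²`. -/
noncomputable def symWeight {n : ℕ} (μ : FreeMonoid (Fin n) → ℝ) (k : Fin n → ℕ) : ℝ :=
  ∑ α ∈ (wordsOfType_finite k).toFinset, 1 / weightProd μ α ^ 2

/-- `y^(k) = (1 / ω_k) ∑_{α ∈ Λ_k} (1 / μ(α, g_0)) e_α`. -/
noncomputable def symVector {n : ℕ} (μ : FreeMonoid (Fin n) → ℝ) (k : Fin n → ℕ) : FockSpace n :=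
  ((1 / symWeight μ k : ℝ) : ℂ) •
    ∑ α ∈ (wordsOfType_finite k).toFinset, ((1 / weightProd μ α : ℝ) : ℂ) • fockBasis α

/-- The symmetric weighted Fock space `F_s²(μ)`: the closed span of the vectors `y^(k)`. -/
noncomputable def symFock {n : ℕ} (μ : FreeMonoid (Fin n) → ℝ) : Submodule ℂ (FockSpace n) :=
  (Submodule.span ℂ (Set.range (symVector μ))).topologicalClosure

instance symFock_completeSpace {n : ℕ} (μ : FreeMonoid (Fin n) → ℝ) :
    CompleteSpace (symFock μ) :=
  (Submodule.isClosed_topologicalClosure _).completeSpace_coe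

/-- The compression `B_i = P_{F_s²(μ)} W_i |_{F_s²(μ)}`. -/
noncomputable def symShift {n : ℕ} (μ : FreeMonoid (Fin n) → ℝ) (hμ : IsWeightSequence μ)
    (i : Fin n) : symFock μ →L[ℂ] symFock μ :=
  (symFock μ).orthogonalProjectionOnto ∘L multiShift μ hμ i ∘L (symFock μ).subtypeL

/-! ### The weak-star topology, invariant subspaces and reflexivity -/

/-- The weak-star (that is, `σ`-weak) topology of `B(H)`: the coarsest topology for which all
functionals `T ↦ ∑_j ⟪y_j, T x_j⟫`, with `∑ ‖x_j‖² < ∞` and `∑ ‖y_j‖² < ∞`, are continuous; these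
functionals are exactly the elements of the predual of `B(H)`. -/
noncomputable abbrev weakStarTopology (H : Type*) [NormedAddCommGroup H] [InnerProductSpace ℂ H] :
    TopologicalSpace (H →L[ℂ] H) :=
  ⨅ (x : lp (fun _ : ℕ => H) 2) (y : lp (fun _ : ℕ => H) 2),
    TopologicalSpace.induced (fun T : H →L[ℂ] H => ∑' j, inner ℂ (y j) (T (x j))) inferInstance

/-- The smallest weak-star closed subalgebra of `B(H)` that contains the identity and the set
`S`. -/
noncomputable def weakStarAdjoin {H : Type*} [NormedAddCommGroup H] [InnerProductSpace ℂ H]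
    (S : Set (H →L[ℂ] H)) : Subalgebra ℂ (H →L[ℂ] H) :=
  sInf {𝒜 | S ⊆ 𝒜 ∧ IsClosed[weakStarTopology H] (𝒜 : Set (H →L[ℂ] H))}

/-- `Lat 𝒰`: the closed subspaces that are invariant under every operator in `𝒰`. -/
def invariantSubspaces {H : Type*} [NormedAddCommGroup H] [InnerProductSpace ℂ H]
    (𝒰 : Set (H →L[ℂ] H)) : Set (Submodule ℂ H) :=
  {M | IsClosed (M : Set H) ∧ ∀ A ∈ 𝒰, ∀ x ∈ M, A x ∈ M}

/-- `Alg 𝒮`: the operators that leave every member of `𝒮` invariant. -/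
def operatorsLeaving {H : Type*} [NormedAddCommGroup H] [InnerProductSpace ℂ H]
    (𝒮 : Set (Submodule ℂ H)) : Set (H →L[ℂ] H) :=
  {A | ∀ M ∈ 𝒮, ∀ x ∈ M, A x ∈ M}

/-- An algebra `𝒰` of bounded operators is reflexive if `𝒰 = Alg Lat 𝒰`. -/
def IsReflexive {H : Type*} [NormedAddCommGroup H] [InnerProductSpace ℂ H]
    (𝒰 : Subalgebra ℂ (H →L[ℂ] H)) : Prop :=
  (𝒰 : Set (H →L[ℂ] H)) = operatorsLeaving (invariantSubspaces (𝒰 : Set (H →L[ℂ] H)))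

/-- The Hardy algebra `F_s^∞(μ)`: the weak-star closed algebra generated by `B_1, …, B_n` and the
identity. -/
noncomputable def symHardyAlgebra {n : ℕ} (μ : FreeMonoid (Fin n) → ℝ)
    (hμ : IsWeightSequence μ) : Subalgebra ℂ (symFock μ →L[ℂ] symFock μ) :=
  weakStarAdjoin (Set.range (symShift μ hμ))

end WeightedFock

/-!
Think of `y^(k)` as the monomial `z ^ k`, so that `B_i` is multiplication by `z_i`. If evaluation
at `z` is bounded, the vector `κ_z` representing it is an eigenvector of every `B_i†`, so its
orthogonal complement is invariant and `κ_z` is an eigenvector of `A†` for every `A ∈ Alg Lat`.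
Since `𝒟(μ)` contains a neighborhood of the origin, uniqueness of power series coefficients shows
that `A` is multiplication by the function `φ = A y^(0)`.

The Fejér means of the power series of `φ`, evaluated at `B`, are polynomials in `B`. On the matrix
entries `⟪y^(m), A y^(k)⟫` they act as multiplication by the Fejér kernel in `|m| - |k|`; this is
the Gram kernel of a family of unit vectors, hence a contractive Schur multiplier. The Fejér means
are therefore bounded by `‖A‖`, converge to `A` on matrix entries, and thus converge weak-star.
-/

namespace WeightedFock

open Filter
open scoped InnerProductSpace

section PowerSeries

open Finset

variable {𝕜 ι : Type*} [NontriviallyNormedField 𝕜] [Fintype ι]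

theorem eq_zero_of_eventually_hasSum_pow {p : ℕ → 𝕜}
    (h : ∀ᶠ t in 𝓝 (0 : 𝕜), HasSum (fun d => t ^ d * p d) 0) : p = 0 := by
  have hp : HasFPowerSeriesAt (0 : 𝕜 → 𝕜) (FormalMultilinearSeries.ofScalars 𝕜 p) 0 := by
    rw [hasFPowerSeriesAt_iff]
    simpa [FormalMultilinearSeries.coeff_ofScalars] using h
  ext d
  rw [← FormalMultilinearSeries.coeff_ofScalars (𝕜 := 𝕜) (p := p) (n := d), hp.eq_zero]
  rfl

theorem hasSum_piAntidiag_of_hasSum [DecidableEq ι] [CompleteSpace 𝕜] {c : (ι → ℕ) → 𝕜}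
    {z : ι → 𝕜} {s t : 𝕜} (h : HasSum (fun k => c k * ∏ i, (t • z) i ^ k i) s) :
    HasSum (fun d => t ^ d * ∑ k ∈ piAntidiag univ d, c k * ∏ i, z i ^ k i) s := by
  refine (h.tsum_fiberwise fun k => ∑ i, k i).congr_fun fun d => ?_
  have hfiber : (fun k : ι → ℕ => ∑ i, k i) ⁻¹' {d} = (piAntidiag univ d : Finset (ι → ℕ)) := by
    ext k; simp
  rw [hfiber, Finset.tsum_subtype' (piAntidiag univ d) fun k => c k * ∏ i, (t • z) i ^ k i,
    mul_sum]
  refine sum_congr rfl fun k hk => ?_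
  have hk : ∑ i, k i = d := (mem_piAntidiag.1 hk).1
  simp only [Pi.smul_apply, smul_eq_mul, mul_pow, prod_mul_distrib, prod_pow_eq_pow_sum, hk]
  ring

theorem eq_zero_of_forall_sum_piAntidiag [DecidableEq ι] {R : Type*} [CommRing R] [IsDomain R]
    [Infinite R] {c : (ι → ℕ) → R}
    (h : ∀ (z : ι → R) (d : ℕ), ∑ k ∈ piAntidiag univ d, c k * ∏ i, z i ^ k i = 0) : c = 0 := by
  ext k
  let p : MvPolynomial ι R := ∑ l ∈ piAntidiag univ (∑ i, k i),
    MvPolynomial.monomial (Finsupp.equivFunOnFinite.symm l) (c l)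
  have hp : p = 0 := MvPolynomial.funext fun z => by
    simp [p, ← h z (∑ i, k i), MvPolynomial.eval_monomial, Finsupp.prod_fintype]
  simpa [p, MvPolynomial.coeff_sum, MvPolynomial.coeff_monomial] using
    congrArg (MvPolynomial.coeff (Finsupp.equivFunOnFinite.symm k)) hp

theorem eq_zero_of_eventually_hasSum_monomials [CompleteSpace 𝕜] {c : (ι → ℕ) → 𝕜}
    (h : ∀ᶠ z in 𝓝 (0 : ι → 𝕜), HasSum (fun k => c k * ∏ i, z i ^ k i) 0) : c = 0 := by
  classical
  refine eq_zero_of_forall_sum_piAntidiag fun z => congrFun (eq_zero_of_eventually_hasSum_pow ?_)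
  have hz : Tendsto (fun t : 𝕜 => t • z) (𝓝 0) (𝓝 0) :=
    (continuous_id.smul continuous_const).tendsto' 0 0 (zero_smul 𝕜 z)
  exact (hz.eventually h).mono fun t ht => hasSum_piAntidiag_of_hasSum ht

end PowerSeries

section OrthogonalBasis

variable {𝕜 κ H G : Type*} [RCLike 𝕜] [NormedAddCommGroup H] [InnerProductSpace 𝕜 H]
  [NormedAddCommGroup G] [InnerProductSpace 𝕜 G] {y : κ → H}

variable (𝕜) in
/-- An orthogonal basis of an inner product space in the Hilbert space sense: nonzero, pairwise
orthogonal vectors, of arbitrary norms, with dense span. -/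
structure IsOrthogonalBasis (y : κ → H) : Prop where
  inner_eq_zero : Pairwise fun k l => ⟪y k, y l⟫_𝕜 = 0
  ne_zero : ∀ k, y k ≠ 0
  dense_span : Dense (Submodule.span 𝕜 (Set.range y) : Set H)

theorem norm_sq_sum_smul (hy : Pairwise fun k l => ⟪y k, y l⟫_𝕜 = 0) (s : Finset κ) (a : κ → 𝕜) :
    ‖∑ k ∈ s, a k • y k‖ ^ 2 = ∑ k ∈ s, ‖a k‖ ^ 2 * ‖y k‖ ^ 2 := by
  classical
  induction s using Finset.induction_on with
  | empty => simp
  | insert k s hk ih =>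
    have horth : ⟪a k • y k, ∑ l ∈ s, a l • y l⟫_𝕜 = 0 := by
      rw [inner_sum]
      refine Finset.sum_eq_zero fun l hl => ?_
      rw [inner_smul_left, inner_smul_right, hy (ne_of_mem_of_not_mem hl hk).symm]
      simp
    rw [Finset.sum_insert hk, Finset.sum_insert hk, ← ih, sq,
      norm_add_sq_eq_norm_sq_add_norm_sq_of_inner_eq_zero _ _ horth, norm_smul]
    ring

theorem inner_sum_smul_apply_sum_smul (T : H →L[𝕜] H) (s t : Finset κ) (b a : κ → 𝕜) :
    ⟪∑ l ∈ s, b l • y l, T (∑ k ∈ t, a k • y k)⟫_𝕜 =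
      ∑ l ∈ s, ∑ k ∈ t, starRingEnd 𝕜 (b l) * a k * ⟪y l, T (y k)⟫_𝕜 := by
  simp only [map_sum, map_smul, sum_inner, inner_sum, inner_smul_left, inner_smul_right,
    Finset.mul_sum]
  rw [Finset.sum_comm]
  exact Finset.sum_congr rfl fun l _ => Finset.sum_congr rfl fun k _ => by ring

section SchurMultiplier

variable {J : Type*} (e : HilbertBasis J 𝕜 G) {u w : κ → G}

theorem hasSum_norm_inner_sq (g : G) : HasSum (fun m => ‖⟪e m, g⟫_𝕜‖ ^ 2) (‖g‖ ^ 2) := by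
  simpa [e.repr_apply_apply] using lp.hasSum_norm (p := 2) (by norm_num) (e.repr g)

theorem hasSum_norm_sq_sum_smul_inner (hy : Pairwise fun k l => ⟪y k, y l⟫_𝕜 = 0) (u : κ → G)
    (s : Finset κ) (a : κ → 𝕜) :
    HasSum (fun m => ‖∑ k ∈ s, (a k * ⟪e m, u k⟫_𝕜) • y k‖ ^ 2)
      (∑ k ∈ s, ‖a k‖ ^ 2 * ‖y k‖ ^ 2 * ‖u k‖ ^ 2) := by
  refine (hasSum_sum fun k _ => (hasSum_norm_inner_sq e (u k)).mul_left
    (‖a k‖ ^ 2 * ‖y k‖ ^ 2)).congr_fun fun m => ?_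
  rw [norm_sq_sum_smul hy]
  exact Finset.sum_congr rfl fun k _ => by rw [norm_mul]; ring

/-- Expanding the Gram kernel `⟪w l, u k⟫` in the orthonormal basis `e` writes `S` weakly as
`∑ m, Q_m† A P_m`, where `P_m` and `Q_m` are diagonal with entries `⟪e m, u k⟫` and `⟪e m, w l⟫`. -/
theorem hasSum_inner_sum_smul_inner {A S : H →L[𝕜] H}
    (hS : ∀ k l, ⟪y l, S (y k)⟫_𝕜 = ⟪w l, u k⟫_𝕜 * ⟪y l, A (y k)⟫_𝕜) (s t : Finset κ)
    (b a : κ → 𝕜) :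
    HasSum (fun m =>
        ⟪∑ l ∈ s, (b l * ⟪e m, w l⟫_𝕜) • y l, A (∑ k ∈ t, (a k * ⟪e m, u k⟫_𝕜) • y k)⟫_𝕜)
      ⟪∑ l ∈ s, b l • y l, S (∑ k ∈ t, a k • y k)⟫_𝕜 := by
  simp only [inner_sum_smul_apply_sum_smul]
  refine hasSum_sum fun l _ => hasSum_sum fun k _ => ?_
  rw [hS, mul_left_comm]
  refine ((e.hasSum_inner_mul_inner (w l) (u k)).mul_right _).congr_fun fun m => ?_
  rw [map_mul, inner_conj_symm]
  ring

theorem norm_inner_apply_le_half (A : H →L[𝕜] H) (x z : H) :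
    ‖⟪z, A x⟫_𝕜‖ ≤ ‖A‖ / 2 * (‖z‖ ^ 2 + ‖x‖ ^ 2) :=
  calc ‖⟪z, A x⟫_𝕜‖ ≤ ‖z‖ * ‖A x‖ := norm_inner_le_norm _ _
    _ ≤ ‖z‖ * (‖A‖ * ‖x‖) := by gcongr; exact A.le_opNorm x
    _ = ‖A‖ / 2 * (2 * ‖z‖ * ‖x‖) := by ring
    _ ≤ ‖A‖ / 2 * (‖z‖ ^ 2 + ‖x‖ ^ 2) := by gcongr; exact two_mul_le_add_sq _ _

variable [CompleteSpace G] {A S : H →L[𝕜] H}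

theorem norm_inner_apply_le_half_of_gram (hy : Pairwise fun k l => ⟪y k, y l⟫_𝕜 = 0)
    (hu : ∀ k, ‖u k‖ ≤ 1) (hw : ∀ k, ‖w k‖ ≤ 1)
    (hS : ∀ k l, ⟪y l, S (y k)⟫_𝕜 = ⟪w l, u k⟫_𝕜 * ⟪y l, A (y k)⟫_𝕜) {x z : H}
    (hx : x ∈ Submodule.span 𝕜 (Set.range y)) (hz : z ∈ Submodule.span 𝕜 (Set.range y)) :
    ‖⟪z, S x⟫_𝕜‖ ≤ ‖A‖ / 2 * (‖z‖ ^ 2 + ‖x‖ ^ 2) := by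
  obtain ⟨a, rfl⟩ := Finsupp.mem_span_range_iff_exists_finsupp.1 hx
  obtain ⟨b, rfl⟩ := Finsupp.mem_span_range_iff_exists_finsupp.1 hz
  obtain ⟨J, e, -⟩ := exists_hilbertBasis 𝕜 G
  have hle (v : κ → G) (hv : ∀ k, ‖v k‖ ≤ 1) (s : Finset κ) (c : κ → 𝕜) :
      ∑ k ∈ s, ‖c k‖ ^ 2 * ‖y k‖ ^ 2 * ‖v k‖ ^ 2 ≤ ‖∑ k ∈ s, c k • y k‖ ^ 2 := by
    rw [norm_sq_sum_smul hy]
    exact Finset.sum_le_sum fun k _ => mul_le_of_le_one_right (by positivity)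
      (pow_le_one₀ (norm_nonneg _) (hv k))
  refine ((hasSum_inner_sum_smul_inner e hS b.support a.support b a).norm_le_of_bounded
    (((hasSum_norm_sq_sum_smul_inner e hy w b.support b).add
      (hasSum_norm_sq_sum_smul_inner e hy u a.support a)).mul_left (‖A‖ / 2))
    fun m => norm_inner_apply_le_half A _ _).trans ?_
  gcongr
  exacts [hle w hw _ _, hle u hu _ _]

theorem opNorm_le_of_gram (hy : IsOrthogonalBasis 𝕜 y)
    (hu : ∀ k, ‖u k‖ ≤ 1) (hw : ∀ k, ‖w k‖ ≤ 1)
    (hS : ∀ k l, ⟪y l, S (y k)⟫_𝕜 = ⟪w l, u k⟫_𝕜 * ⟪y l, A (y k)⟫_𝕜) : ‖S‖ ≤ ‖A‖ := by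
  have hbound (p : H × H) : ‖⟪p.1, S p.2⟫_𝕜‖ ≤ ‖A‖ / 2 * (‖p.1‖ ^ 2 + ‖p.2‖ ^ 2) := by
    refine (hy.dense_span.prod hy.dense_span).induction (P := fun p : H × H =>
      ‖⟪p.1, S p.2⟫_𝕜‖ ≤ ‖A‖ / 2 * (‖p.1‖ ^ 2 + ‖p.2‖ ^ 2)) (fun p hp => ?_) ?_ p
    · exact norm_inner_apply_le_half_of_gram hy.inner_eq_zero hu hw hS hp.2 hp.1
    · exact isClosed_le (by fun_prop) (by fun_prop)
  refine ContinuousLinearMap.opNorm_le_of_re_inner_le (norm_nonneg _) fun x z hx hz => ?_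
  rw [inner_re_symm]
  refine (RCLike.re_le_norm _).trans ((hbound (z, x)).trans_eq ?_)
  simp only [hx, hz]
  ring

end SchurMultiplier

end OrthogonalBasis

section BasisCoeff

variable {𝕜 κ H : Type*} [RCLike 𝕜] [NormedAddCommGroup H] [InnerProductSpace 𝕜 H] {y : κ → H}

variable (𝕜) in
/-- The `k`-th coefficient of a vector with respect to the orthogonal basis `y`. -/
noncomputable def basisCoeff (y : κ → H) (k : κ) : H →L[𝕜] 𝕜 := (⟪y k, y k⟫_𝕜)⁻¹ • innerSL 𝕜 (y k)

namespace IsOrthogonalBasis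

variable (hy : IsOrthogonalBasis 𝕜 y)
include hy

theorem inner_eq_mul_basisCoeff (k : κ) (x : H) :
    ⟪y k, x⟫_𝕜 = ⟪y k, y k⟫_𝕜 * basisCoeff 𝕜 y k x :=
  (mul_inv_cancel_left₀ (inner_self_ne_zero.2 (hy.ne_zero k)) _).symm

theorem basisCoeff_basis [DecidableEq κ] (k l : κ) :
    basisCoeff 𝕜 y k (y l) = if k = l then 1 else 0 := by
  change (⟪y k, y k⟫_𝕜)⁻¹ * ⟪y k, y l⟫_𝕜 = _
  split_ifs with h
  · rw [← h, inv_mul_cancel₀ (inner_self_ne_zero.2 (hy.ne_zero k))]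
  · rw [hy.inner_eq_zero h, mul_zero]

theorem ext_continuousLinearMap {F : Type*} [NormedAddCommGroup F] [NormedSpace 𝕜 F]
    {f g : H →L[𝕜] F} (h : ∀ k, f (y k) = g (y k)) : f = g :=
  ContinuousLinearMap.ext_on hy.dense_span (Set.forall_mem_range.2 h)

theorem orthonormal : Orthonormal 𝕜 fun k => ((‖y k‖⁻¹ : ℝ) : 𝕜) • y k := by
  refine ⟨fun k => ?_, fun k l hkl => ?_⟩
  · simp [norm_smul, hy.ne_zero k]
  · simp [inner_smul_left, inner_smul_right, hy.inner_eq_zero hkl]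

theorem hasSum_basisCoeff_mul_inner [CompleteSpace H] (z x : H) :
    HasSum (fun k => basisCoeff 𝕜 y k x * ⟪z, y k⟫_𝕜) ⟪z, x⟫_𝕜 := by
  let e := HilbertBasis.mk hy.orthonormal (by
    rw [← Submodule.dense_iff_topologicalClosure_eq_top.1 hy.dense_span]
    refine Submodule.topologicalClosure_mono (Submodule.span_le.2 ?_)
    rintro _ ⟨k, rfl⟩
    have hk : y k = (‖y k‖ : 𝕜) • (((‖y k‖⁻¹ : ℝ) : 𝕜) • y k) := by
      simp [smul_smul, hy.ne_zero k]
    rw [hk]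
    exact Submodule.smul_mem _ _ (Submodule.subset_span ⟨k, rfl⟩))
  refine (e.hasSum_inner_mul_inner z x).congr_fun fun k => ?_
  simp only [e, HilbertBasis.coe_mk, inner_smul_left, inner_smul_right, RCLike.conj_ofReal,
    basisCoeff, smul_apply, innerSL_apply_apply, smul_eq_mul, inner_self_eq_norm_sq_to_K]
  push_cast
  ring

theorem eq_of_forall_inner_eq {x z : H} (h : ∀ k, ⟪y k, x⟫_𝕜 = ⟪y k, z⟫_𝕜) : x = z := by
  have hfun : innerSL 𝕜 x = innerSL 𝕜 z := hy.ext_continuousLinearMap fun k => by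
    rw [innerSL_apply_apply, innerSL_apply_apply, ← inner_conj_symm, h, inner_conj_symm]
  exact ext_inner_right 𝕜 fun v => congrArg (· v) hfun

theorem eq_zero_of_basisCoeff_eq_zero {x : H} (h : ∀ k, basisCoeff 𝕜 y k x = 0) : x = 0 :=
  hy.eq_of_forall_inner_eq fun k => by
    rw [hy.inner_eq_mul_basisCoeff, h, mul_zero, inner_zero_right]

end IsOrthogonalBasis

end BasisCoeff

section FejerKernel

/-- The weight `max (1 - d / (N + 1)) 0` of the terms of degree `d` in the `N`-th Fejér mean; it is
the truncated subtraction that makes it vanish for `d > N`. -/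
noncomputable def fejerWeight (N d : ℕ) : ℝ := ((N + 1 - d : ℕ) : ℝ) / (N + 1)

theorem fejerWeight_zero (N : ℕ) : fejerWeight N 0 = 1 := by
  simp [fejerWeight, div_self (Nat.cast_add_one_ne_zero (R := ℝ) N)]

theorem fejerWeight_of_lt {N d : ℕ} (h : N < d) : fejerWeight N d = 0 := by
  simp [fejerWeight, Nat.sub_eq_zero_of_le h]

theorem tendsto_fejerWeight (d : ℕ) : Tendsto (fejerWeight · d) atTop (𝓝 1) := by
  have h : Tendsto (fun N : ℕ => 1 - (d : ℝ) * (1 / ((N : ℝ) + 1))) atTop (𝓝 1) := by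
    simpa using (tendsto_one_div_add_atTop_nhds_zero_nat.const_mul (d : ℝ)).const_sub (1 : ℝ)
  refine h.congr' ?_
  filter_upwards [eventually_ge_atTop d] with N hN
  have : (N : ℝ) + 1 ≠ 0 := by positivity
  rw [fejerWeight, Nat.cast_sub (by omega)]
  push_cast
  field_simp

theorem inner_sum_sum_of_orthonormal {𝕜 J G : Type*} [RCLike 𝕜] [NormedAddCommGroup G]
    [InnerProductSpace 𝕜 G] [DecidableEq J] {e : J → G} (he : Orthonormal 𝕜 e) (s t : Finset J) :
    ⟪∑ m ∈ s, e m, ∑ m ∈ t, e m⟫_𝕜 = (s ∩ t).card := by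
  simp [sum_inner, inner_sum, orthonormal_iff_ite.1 he, Finset.inter_comm t s]

theorem card_Ioc_inter_Ioc_add (a b r : ℕ) :
    (Finset.Ioc a (a + r) ∩ Finset.Ioc b (b + r)).card = r - Nat.dist a b := by
  rw [Finset.Ioc_inter_Ioc, Nat.card_Ioc, Nat.dist]
  omega

theorem exists_gram_fejerWeight (𝕜 : Type*) [RCLike 𝕜] (N : ℕ) :
    ∃ u : ℕ → lp (fun _ : ℕ => 𝕜) 2, (∀ a, ‖u a‖ = 1) ∧
      ∀ a b, ⟪u a, u b⟫_𝕜 = (fejerWeight N (Nat.dist a b) : 𝕜) := by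
  obtain ⟨e⟩ : Nonempty (HilbertBasis ℕ 𝕜 (lp (fun _ : ℕ => 𝕜) 2)) := ⟨⟨.refl 𝕜 _⟩⟩
  -- `u a` is the normalized indicator of `(a, a + N + 1]`; two such windows overlap in
  -- `N + 1 - dist a b` points.
  let u (a : ℕ) := (((√(N + 1))⁻¹ : ℝ) : 𝕜) • ∑ m ∈ Finset.Ioc a (a + (N + 1)), e m
  have hu (a b : ℕ) : ⟪u a, u b⟫_𝕜 = (fejerWeight N (Nat.dist a b) : 𝕜) := by
    simp only [u, inner_smul_left, inner_smul_right, inner_sum_sum_of_orthonormal e.orthonormal,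
      card_Ioc_inter_Ioc_add, fejerWeight, RCLike.conj_ofReal]
    norm_cast
    rw [← mul_assoc, ← mul_inv, Real.mul_self_sqrt (by positivity), inv_mul_eq_div]
  refine ⟨u, fun a => ?_, hu⟩
  have hsq : ‖u a‖ ^ 2 = 1 := by
    have h := hu a a
    rw [inner_self_eq_norm_sq_to_K, Nat.dist_self, fejerWeight_zero] at h
    exact_mod_cast h
  exact (pow_eq_one_iff_of_nonneg (norm_nonneg _) two_ne_zero).1 hsq

end FejerKernel

section WeakStar

theorem tendsto_of_dense_span {𝕜 E F α : Type*} [NontriviallyNormedField 𝕜]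
    [NormedAddCommGroup E] [NormedSpace 𝕜 E] [NormedAddCommGroup F] [NormedSpace 𝕜 F]
    {l : Filter α} {f : α → E →L[𝕜] F} {g : E →L[𝕜] F} {C : ℝ} (hf : ∀ N, ‖f N‖ ≤ C) {s : Set E}
    (hs : Dense (Submodule.span 𝕜 s : Set E))
    (h : ∀ x ∈ s, Tendsto (f · x) l (𝓝 (g x))) (x : E) : Tendsto (f · x) l (𝓝 (g x)) := by
  have hiff : Equicontinuous (fun N => ⇑(f N)) ↔ ∃ C, ∀ N, ‖f N‖ ≤ C :=
    (NormedSpace.equicontinuous_TFAE f).out 1 5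
  have hequi := hiff.2 ⟨C, hf⟩
  refine hs.induction (P := fun x => Tendsto (f · x) l (𝓝 (g x))) (fun x hx => ?_)
    (hequi.isClosed_setOfPred_tendsto g.continuous) x
  induction hx using Submodule.span_induction with
  | mem x hx => exact h x hx
  | zero => simpa only [map_zero] using tendsto_const_nhds
  | add x y _ _ hx hy => simpa only [map_add] using hx.add hy
  | smul a x _ hx => simpa only [map_smul] using hx.const_smul a

variable {H : Type*} [NormedAddCommGroup H] [InnerProductSpace ℂ H]

theorem tendsto_inner_of_dense_span {α : Type*} {l : Filter α} {T : α → H →L[ℂ] H}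
    {A : H →L[ℂ] H} {C : ℝ} (hT : ∀ N, ‖T N‖ ≤ C) {s : Set H}
    (hs : Dense (Submodule.span ℂ s : Set H))
    (h : ∀ x ∈ s, ∀ y ∈ s, Tendsto (fun N => ⟪y, T N x⟫_ℂ) l (𝓝 ⟪y, A x⟫_ℂ)) (x y : H) :
    Tendsto (fun N => ⟪y, T N x⟫_ℂ) l (𝓝 ⟪y, A x⟫_ℂ) := by
  have hleft (y : H) (hy : y ∈ s) : Tendsto (fun N => ⟪y, T N x⟫_ℂ) l (𝓝 ⟪y, A x⟫_ℂ) :=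
    tendsto_of_dense_span (f := fun N => innerSL ℂ y ∘L T N) (g := innerSL ℂ y ∘L A)
      (C := ‖y‖ * C) (fun N => by
        grw [ContinuousLinearMap.opNorm_comp_le, innerSL_apply_norm, hT N])
      hs (fun x hx => h x hx y hy) x
  have hconj : Tendsto (fun N => ⟪T N x, y⟫_ℂ) l (𝓝 ⟪A x, y⟫_ℂ) :=
    tendsto_of_dense_span (f := fun N => innerSL ℂ (T N x)) (g := innerSL ℂ (A x))
      (C := C * ‖x‖) (fun N => by
        rw [innerSL_apply_norm]; exact (T N).le_of_opNorm_le (hT N) x) hs (fun y hy => by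
        simpa [Function.comp_def] using (Complex.continuous_conj.tendsto _).comp (hleft y hy)) y
  simpa [Function.comp_def] using (Complex.continuous_conj.tendsto _).comp hconj

theorem tendsto_weakStar_of_forall_inner {α : Type*} {l : Filter α} [l.IsCountablyGenerated]
    {T : α → H →L[ℂ] H} {A : H →L[ℂ] H} {C : ℝ} (hT : ∀ N, ‖T N‖ ≤ C)
    (h : ∀ x y : H, Tendsto (fun N => ⟪y, T N x⟫_ℂ) l (𝓝 ⟪y, A x⟫_ℂ)) :
    Tendsto T l (@nhds _ (weakStarTopology H) A) := by
  simp only [nhds_iInf, nhds_induced, tendsto_iInf, tendsto_comap_iff]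
  intro x y
  have hsq (z : lp (fun _ : ℕ => H) 2) : Summable fun j => ‖z j‖ ^ 2 := by
    simpa using (lp.hasSum_norm (p := 2) (by norm_num) z).summable
  refine tendsto_tsum_of_dominated_convergence
    (bound := fun j => C / 2 * (‖y j‖ ^ 2 + ‖x j‖ ^ 2)) (((hsq y).add (hsq x)).mul_left _)
    (fun j => h (x j) (y j)) (Eventually.of_forall fun N j => ?_)
  refine (norm_inner_apply_le_half (T N) _ _).trans ?_
  gcongr
  exact hT N

theorem continuous_weakStar_inner (x y : H) :
    Continuous[weakStarTopology H, inferInstance] fun T : H →L[ℂ] H => ⟪y, T x⟫_ℂ := by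
  have h (T : H →L[ℂ] H) : ⟪y, T x⟫_ℂ = ∑' j, ⟪(lp.single 2 0 y : lp (fun _ : ℕ => H) 2) j,
      T ((lp.single 2 0 x : lp (fun _ : ℕ => H) 2) j)⟫_ℂ := by
    rw [tsum_eq_single 0 fun j hj => by rw [lp.single_apply_ne _ _ _ hj]; simp]
    simp
  simp only [h]
  exact continuous_iff_le_induced.2 ((iInf_le _ _).trans (iInf_le _ _))

theorem subset_weakStarAdjoin (S : Set (H →L[ℂ] H)) : S ⊆ weakStarAdjoin S :=
  fun _ hT => Algebra.mem_sInf.2 fun _ h𝒜 => h𝒜.1 hT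

theorem isClosed_weakStarAdjoin (S : Set (H →L[ℂ] H)) :
    IsClosed[weakStarTopology H] (weakStarAdjoin S : Set (H →L[ℂ] H)) := by
  let _ := weakStarTopology H
  rw [weakStarAdjoin, Algebra.coe_sInf]
  exact isClosed_biInter fun _ h𝒜 => h𝒜.2

/-- The algebra of the operators that leave the subspace `M` invariant. -/
def stabilizer (M : Submodule ℂ H) : Subalgebra ℂ (H →L[ℂ] H) where
  carrier := {T | ∀ x ∈ M, T x ∈ M}
  mul_mem' hS hT x hx := hS _ (hT x hx)
  add_mem' hS hT x hx := M.add_mem (hS x hx) (hT x hx)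
  algebraMap_mem' c x hx := by
    simpa [Algebra.algebraMap_eq_smul_one] using M.smul_mem c hx

theorem isClosed_stabilizer [CompleteSpace H] {M : Submodule ℂ H} (hM : IsClosed (M : Set H)) :
    IsClosed[weakStarTopology H] (stabilizer M : Set (H →L[ℂ] H)) := by
  let _ := weakStarTopology H
  have : CompleteSpace M := hM.completeSpace_coe
  have h : (stabilizer M : Set (H →L[ℂ] H)) =
      ⋂ x ∈ M, ⋂ y ∈ Mᗮ, (fun T : H →L[ℂ] H => ⟪y, T x⟫_ℂ) ⁻¹' {0} := by
    ext T
    simp only [Set.mem_iInter, Set.mem_preimage, Set.mem_singleton_iff, ← Submodule.mem_orthogonal,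
      M.orthogonal_orthogonal]
    rfl
  rw [h]
  exact isClosed_biInter fun x _ => isClosed_biInter fun y _ =>
    isClosed_singleton.preimage (continuous_weakStar_inner x y)

theorem invariantSubspaces_weakStarAdjoin [CompleteSpace H] (S : Set (H →L[ℂ] H)) :
    invariantSubspaces (weakStarAdjoin S : Set (H →L[ℂ] H)) = invariantSubspaces S := by
  refine Set.Subset.antisymm (fun M hM => ⟨hM.1, fun T hT => hM.2 T (subset_weakStarAdjoin S hT)⟩)
    fun M hM => ⟨hM.1, fun T hT => ?_⟩
  exact Algebra.mem_sInf.1 hT (stabilizer M) ⟨hM.2, isClosed_stabilizer hM.1⟩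

theorem inner_apply_of_mem_operatorsLeaving {S : Set (H →L[ℂ] H)} {A : H →L[ℂ] H}
    (hA : A ∈ operatorsLeaving (invariantSubspaces S)) {κ y₀ : H}
    (hS : ∀ T ∈ S, ∀ x, ⟪κ, x⟫_ℂ = 0 → ⟪κ, T x⟫_ℂ = 0) (h₀ : ⟪κ, y₀⟫_ℂ = 1) (x : H) :
    ⟪κ, A x⟫_ℂ = ⟪κ, x⟫_ℂ * ⟪κ, A y₀⟫_ℂ := by
  have hker : (innerSL ℂ κ).ker ∈ invariantSubspaces S :=
    ⟨(innerSL ℂ κ).isClosed_ker, hS⟩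
  have hx : ⟪κ, x - ⟪κ, x⟫_ℂ • y₀⟫_ℂ = 0 := by
    rw [inner_sub_right, inner_smul_right, h₀, mul_one, sub_self]
  have hAx : ⟪κ, A (x - ⟪κ, x⟫_ℂ • y₀)⟫_ℂ = 0 := hA _ hker _ hx
  rw [map_sub, map_smul, inner_sub_right, inner_smul_right] at hAx
  exact sub_eq_zero.1 hAx

end WeakStar

section MonomialShift

variable {ι H : Type*} [NormedAddCommGroup H] [InnerProductSpace ℂ H] {y : (ι → ℕ) → H}
  {k l : ι → ℕ} {S T : H →L[ℂ] H}

/-- The operator `T` translates the indices of the family `y` by `k`. If `y l` is thought of as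
the monomial `z ^ l`, then `T` is multiplication by `z ^ k`. -/
def IsTranslation (y : (ι → ℕ) → H) (k : ι → ℕ) (T : H →L[ℂ] H) : Prop :=
  ∀ l, T (y l) = y (k + l)

/-- The vector `κ` represents evaluation at the point `z`, if `y k` is thought of as the monomial
`z ^ k`. -/
def IsPointEvaluation [Fintype ι] (y : (ι → ℕ) → H) (z : ι → ℂ) (κ : H) : Prop :=
  ∀ k, ⟪κ, y k⟫_ℂ = ∏ i, z i ^ k i

theorem isTranslation_one (y : (ι → ℕ) → H) : IsTranslation y 0 1 := fun l => by
  rw [zero_add]; rfl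

namespace IsTranslation

theorem mul (hS : IsTranslation y k S) (hT : IsTranslation y l T) :
    IsTranslation y (k + l) (S * T) := fun m => by
  rw [mul_apply_eq_comp, hT, hS, add_assoc]

theorem basisCoeff_add_apply (hT : IsTranslation y k T) (hy : IsOrthogonalBasis ℂ y)
    (m : ι → ℕ) (x : H) : basisCoeff ℂ y (k + m) (T x) = basisCoeff ℂ y m x := by
  classical
  suffices h : basisCoeff ℂ y (k + m) ∘L T = basisCoeff ℂ y m from congrArg (· x) h
  refine hy.ext_continuousLinearMap fun l => ?_
  simp [hT l, hy.basisCoeff_basis]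

theorem basisCoeff_apply_of_not_le (hT : IsTranslation y k T) (hy : IsOrthogonalBasis ℂ y)
    {m : ι → ℕ} (hkm : ¬k ≤ m) (x : H) : basisCoeff ℂ y m (T x) = 0 := by
  classical
  suffices h : basisCoeff ℂ y m ∘L T = 0 from congrArg (· x) h
  refine hy.ext_continuousLinearMap fun l => ?_
  have hne : m ≠ k + l := fun h => hkm (h ▸ le_self_add)
  simp [hT l, hy.basisCoeff_basis, hne]

theorem inner_apply_of_isPointEvaluation [Fintype ι] (hT : IsTranslation y k T)
    (hy : IsOrthogonalBasis ℂ y) {z : ι → ℂ} {κ : H} (hκ : IsPointEvaluation y z κ) (x : H) :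
    ⟪κ, T x⟫_ℂ = (∏ i, z i ^ k i) * ⟪κ, x⟫_ℂ := by
  suffices h : innerSL ℂ κ ∘L T = (∏ i, z i ^ k i) • innerSL ℂ κ from congrArg (· x) h
  refine hy.ext_continuousLinearMap fun l => ?_
  simp [hT l, hκ _, pow_add, Finset.prod_mul_distrib]

end IsTranslation

theorem exists_isTranslation_mem_adjoin [Finite ι] [DecidableEq ι] {B : ι → H →L[ℂ] H}
    (hB : ∀ i, IsTranslation y (Pi.single i 1) (B i)) (k : ι → ℕ) :
    ∃ T ∈ Algebra.adjoin ℂ (Set.range B), IsTranslation y k T := by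
  cases nonempty_fintype ι
  let P : AddSubmonoid (ι → ℕ) :=
    { carrier := {k | ∃ T ∈ Algebra.adjoin ℂ (Set.range B), IsTranslation y k T}
      zero_mem' := ⟨1, one_mem _, isTranslation_one y⟩
      add_mem' := fun ⟨S, hS, hkS⟩ ⟨T, hT, hlT⟩ => ⟨S * T, mul_mem hS hT, hkS.mul hlT⟩ }
  have hsingle (i : ι) : Pi.single i (k i) ∈ P := by
    have h : Pi.single i 1 ∈ P := ⟨B i, Algebra.subset_adjoin ⟨i, rfl⟩, hB i⟩
    simpa [← Pi.single_smul'] using P.nsmul_mem h (k i)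
  exact Finset.univ_sum_single k ▸ P.sum_mem fun i _ => hsingle i

theorem eq_zero_of_inner_pointEvaluation_eq_zero [Fintype ι] [CompleteSpace H]
    (hy : IsOrthogonalBasis ℂ y) {x : H}
    (h : ∀ᶠ z in 𝓝 (0 : ι → ℂ), ∃ κ, IsPointEvaluation y z κ ∧ ⟪κ, x⟫_ℂ = 0) : x = 0 := by
  classical
  refine hy.eq_zero_of_basisCoeff_eq_zero (congrFun (eq_zero_of_eventually_hasSum_monomials ?_))
  filter_upwards [h] with z ⟨κ, hκ, hx⟩
  simpa only [hx, hκ _] using hy.hasSum_basisCoeff_mul_inner κ x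

theorem apply_eq_of_mem_operatorsLeaving [Fintype ι] [DecidableEq ι] [CompleteSpace H]
    (hy : IsOrthogonalBasis ℂ y) {B : ι → H →L[ℂ] H}
    (hB : ∀ i, IsTranslation y (Pi.single i 1) (B i))
    (heval : ∀ᶠ z in 𝓝 (0 : ι → ℂ), ∃ κ, IsPointEvaluation y z κ)
    {A : H →L[ℂ] H} (hA : A ∈ operatorsLeaving (invariantSubspaces (Set.range B)))
    (hT : IsTranslation y k T) : A (y k) = T (A (y 0)) := by
  refine sub_eq_zero.1 (eq_zero_of_inner_pointEvaluation_eq_zero hy ?_)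
  filter_upwards [heval] with z ⟨κ, hκ⟩
  have hker : ∀ S ∈ Set.range B, ∀ x, ⟪κ, x⟫_ℂ = 0 → ⟪κ, S x⟫_ℂ = 0 := by
    rintro _ ⟨i, rfl⟩ x hx
    rw [(hB i).inner_apply_of_isPointEvaluation hy hκ, hx, mul_zero]
  have hmul := inner_apply_of_mem_operatorsLeaving hA hker (by simpa using hκ 0) (y k)
  exact ⟨κ, hκ, by rw [inner_sub_right, hmul, hκ k, hT.inner_apply_of_isPointEvaluation hy hκ,
    sub_self]⟩

section FejerMean

variable [Fintype ι] [DecidableEq ι] {τ : (ι → ℕ) → H →L[ℂ] H}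

/-- The `N`-th Fejér mean of the formal series `∑ c l • τ l`. -/
noncomputable def fejerMean (τ : (ι → ℕ) → H →L[ℂ] H) (c : (ι → ℕ) → ℂ) (N : ℕ) : H →L[ℂ] H :=
  ∑ l ∈ Finset.Iic (fun _ => N), ((fejerWeight N (∑ i, l i) : ℂ) * c l) • τ l

theorem fejerMean_mem {𝒜 : Subalgebra ℂ (H →L[ℂ] H)} (hτ : ∀ l, τ l ∈ 𝒜) (c : (ι → ℕ) → ℂ)
    (N : ℕ) : fejerMean τ c N ∈ 𝒜 :=
  sum_mem fun l _ => 𝒜.smul_mem (hτ l) _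

theorem basisCoeff_fejerMean (hy : IsOrthogonalBasis ℂ y) (hτ : ∀ l, IsTranslation y l (τ l))
    {A : H →L[ℂ] H} (hA : ∀ k, A (y k) = τ k (A (y 0))) (N : ℕ) (k m : ι → ℕ) :
    basisCoeff ℂ y m (fejerMean τ (fun l => basisCoeff ℂ y l (A (y 0))) N (y k)) =
      fejerWeight N (Nat.dist (∑ i, m i) (∑ i, k i)) * basisCoeff ℂ y m (A (y k)) := by
  simp only [fejerMean, sum_apply, smul_apply, hτ _ _, map_sum, map_smul, hy.basisCoeff_basis,
    smul_eq_mul, mul_ite, mul_one, mul_zero]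
  by_cases hkm : k ≤ m
  · obtain ⟨d, rfl⟩ := exists_add_of_le hkm
    have hdist : Nat.dist (∑ i, (k + d) i) (∑ i, k i) = ∑ i, d i := by
      simp [Nat.dist, Finset.sum_add_distrib]
    simp only [add_comm _ k, add_right_inj]
    rw [Finset.sum_ite_eq, hdist, hA k, (hτ k).basisCoeff_add_apply hy]
    split_ifs with hd
    · rfl
    · obtain ⟨i, hi⟩ : ∃ i, N < d i := by simpa [Pi.le_def] using hd
      have hlt : N < ∑ i, d i := hi.trans_le (Finset.single_le_sum (by simp) (Finset.mem_univ i))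
      rw [fejerWeight_of_lt hlt, Complex.ofReal_zero, zero_mul]
  · rw [hA k, (hτ k).basisCoeff_apply_of_not_le hy hkm, mul_zero]
    refine Finset.sum_eq_zero fun l _ => if_neg ?_
    rintro rfl
    exact hkm le_add_self

theorem inner_fejerMean (hy : IsOrthogonalBasis ℂ y) (hτ : ∀ l, IsTranslation y l (τ l))
    {A : H →L[ℂ] H} (hA : ∀ k, A (y k) = τ k (A (y 0))) (N : ℕ) (k m : ι → ℕ) :
    ⟪y m, fejerMean τ (fun l => basisCoeff ℂ y l (A (y 0))) N (y k)⟫_ℂ =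
      fejerWeight N (Nat.dist (∑ i, m i) (∑ i, k i)) * ⟪y m, A (y k)⟫_ℂ := by
  rw [hy.inner_eq_mul_basisCoeff, basisCoeff_fejerMean hy hτ hA,
    hy.inner_eq_mul_basisCoeff m (A (y k)), mul_left_comm]

theorem opNorm_fejerMean_le (hy : IsOrthogonalBasis ℂ y) (hτ : ∀ l, IsTranslation y l (τ l))
    {A : H →L[ℂ] H} (hA : ∀ k, A (y k) = τ k (A (y 0))) (N : ℕ) :
    ‖fejerMean τ (fun l => basisCoeff ℂ y l (A (y 0))) N‖ ≤ ‖A‖ := by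
  obtain ⟨u, hu, huu⟩ := exists_gram_fejerWeight ℂ N
  refine opNorm_le_of_gram hy (u := fun k => u (∑ i, k i)) (w := fun k => u (∑ i, k i))
    (fun k => (hu _).le) (fun k => (hu _).le) fun k m => ?_
  rw [inner_fejerMean hy hτ hA, huu]
  rfl

theorem tendsto_fejerMean (hy : IsOrthogonalBasis ℂ y) (hτ : ∀ l, IsTranslation y l (τ l))
    {A : H →L[ℂ] H} (hA : ∀ k, A (y k) = τ k (A (y 0))) :
    Tendsto (fejerMean τ fun l => basisCoeff ℂ y l (A (y 0))) atTop
      (@nhds _ (weakStarTopology H) A) := by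
  refine tendsto_weakStar_of_forall_inner (opNorm_fejerMean_le hy hτ hA) <|
    tendsto_inner_of_dense_span (opNorm_fejerMean_le hy hτ hA) hy.dense_span ?_
  rintro _ ⟨k, rfl⟩ _ ⟨m, rfl⟩
  simp only [inner_fejerMean hy hτ hA]
  have hweight : Tendsto (fun N => (fejerWeight N (Nat.dist (∑ i, m i) (∑ i, k i)) : ℂ)) atTop
      (𝓝 1) := (Complex.continuous_ofReal.tendsto 1).comp (tendsto_fejerWeight _)
  simpa only [one_mul] using hweight.mul_const _

end FejerMean

theorem isReflexive_weakStarAdjoin [Fintype ι] [DecidableEq ι] [CompleteSpace H]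
    (hy : IsOrthogonalBasis ℂ y) {B : ι → H →L[ℂ] H}
    (hB : ∀ i, IsTranslation y (Pi.single i 1) (B i))
    (heval : ∀ᶠ z in 𝓝 (0 : ι → ℂ), ∃ κ, IsPointEvaluation y z κ) :
    IsReflexive (weakStarAdjoin (Set.range B)) := by
  refine Set.Subset.antisymm (fun A hA M hM => hM.2 A hA) fun A hA => ?_
  rw [invariantSubspaces_weakStarAdjoin] at hA
  choose τ hτ_mem hτ using exists_isTranslation_mem_adjoin hB
  have hmul (k : ι → ℕ) : A (y k) = τ k (A (y 0)) :=
    apply_eq_of_mem_operatorsLeaving hy hB heval hA (hτ k)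
  have hadjoin := Algebra.adjoin_le (subset_weakStarAdjoin (Set.range B))
  let _ := weakStarTopology H
  exact (isClosed_weakStarAdjoin _).mem_of_tendsto (tendsto_fejerMean hy hτ hmul) <|
    Eventually.of_forall <| fejerMean_mem (fun l => hadjoin (hτ_mem l)) _

end MonomialShift

section Words

variable {n : ℕ} {k l : Fin n → ℕ} {α : FreeMonoid (Fin n)}

theorem prod_pow_single {ι M : Type*} [Fintype ι] [DecidableEq ι] [CommMonoid M] (z : ι → M)
    (i : ι) : ∏ j, z j ^ (Pi.single i 1 : ι → ℕ) j = z i := by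
  simp [Pi.single_apply]

theorem eq_of_mem_wordsOfType (hk : α ∈ wordsOfType k) (hl : α ∈ wordsOfType l) : k = l := by
  funext i
  have h := (hk (Pi.mulSingle i 2)).symm.trans (hl (Pi.mulSingle i 2))
  have hpow (m : Fin n → ℕ) : ∏ j, (Pi.mulSingle i 2 : Fin n → ℂ) j ^ m j = 2 ^ m i := by
    rw [Finset.prod_eq_single i (by simp +contextual [Pi.mulSingle_eq_of_ne]) (by simp),
      Pi.mulSingle_eq_same]
  rw [hpow, hpow] at h
  exact Nat.pow_right_injective le_rfl (by exact_mod_cast h)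

theorem wordsOfType_nonempty (k : Fin n → ℕ) : (wordsOfType k).Nonempty := by
  refine ⟨(List.ofFn fun i => FreeMonoid.of i ^ k i).prod, fun ζ => ?_⟩
  simp [map_list_prod, List.map_ofFn, List.prod_ofFn]

theorem of_mul_mem_wordsOfType (hα : α ∈ wordsOfType k) (i : Fin n) :
    FreeMonoid.of i * α ∈ wordsOfType (Pi.single i 1 + k) := fun ζ => by
  simp only [map_mul, FreeMonoid.lift_eval_of, hα ζ, Pi.add_apply, pow_add,
    Finset.prod_mul_distrib, prod_pow_single]

end Words

section SymmetricFock

variable {n : ℕ} {μ : FreeMonoid (Fin n) → ℝ}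

theorem weightProd_of_mul (i : Fin n) (α : FreeMonoid (Fin n)) :
    weightProd μ (FreeMonoid.of i * α) = μ (FreeMonoid.of i * α) * weightProd μ α := rfl

theorem IsWeightSequence.weight_of_mul_pos (hμ : IsWeightSequence μ) (i : Fin n)
    (α : FreeMonoid (Fin n)) : 0 < μ (FreeMonoid.of i * α) :=
  hμ.pos _ fun h => by simpa using congrArg FreeMonoid.length h

theorem IsWeightSequence.weightProd_pos (hμ : IsWeightSequence μ) (α : FreeMonoid (Fin n)) :
    0 < weightProd μ α := by
  induction α using FreeMonoid.inductionOn' with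
  | one => exact one_pos
  | of_mul i α ih => exact mul_pos (hμ.weight_of_mul_pos i α) ih

theorem IsWeightSequence.symWeight_pos (hμ : IsWeightSequence μ) (k : Fin n → ℕ) :
    0 < symWeight μ k :=
  Finset.sum_pos (fun α _ => one_div_pos.2 (pow_pos (hμ.weightProd_pos α) 2))
    ((wordsOfType_finite k).toFinset_nonempty.2 (wordsOfType_nonempty k))

theorem inner_fockBasis (f : FockSpace n) (α : FreeMonoid (Fin n)) :
    ⟪f, fockBasis α⟫_ℂ = starRingEnd ℂ (f α) := by
  rw [fockBasis, lp.inner_single_right, RCLike.inner_apply, one_mul]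

theorem adjoint_multiShift_apply (hμ : IsWeightSequence μ) (i : Fin n) (f : FockSpace n)
    (α : FreeMonoid (Fin n)) :
    (multiShift μ hμ i).adjoint f α = μ (FreeMonoid.of i * α) * f (FreeMonoid.of i * α) := by
  apply (starRingEnd ℂ).injective
  rw [← inner_fockBasis, ContinuousLinearMap.adjoint_inner_left, multiShift_fockBasis,
    inner_smul_right, inner_fockBasis, map_mul, Complex.conj_ofReal]

theorem symVector_apply_of_mem {k : Fin n → ℕ} {α : FreeMonoid (Fin n)} (hα : α ∈ wordsOfType k)
    (l : Fin n → ℕ) :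
    symVector μ l α = (if k = l then 1 / (symWeight μ l : ℂ) else 0) / weightProd μ α := by
  have hmem : α ∈ wordsOfType l ↔ k = l :=
    ⟨fun h => eq_of_mem_wordsOfType hα h, fun h => h ▸ hα⟩
  rw [symVector, lp.coeFn_smul, Pi.smul_apply, lp.coeFn_sum, Finset.sum_apply]
  simp [fockBasis, Pi.single_apply, hmem, div_eq_mul_inv, ite_mul]

theorem inner_symVector_of_forall_mem (hμ : IsWeightSequence μ) {f : FockSpace n}
    {k : Fin n → ℕ} {c : ℂ} (hf : ∀ α ∈ wordsOfType k, f α = c / weightProd μ α) :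
    ⟪f, symVector μ k⟫_ℂ = starRingEnd ℂ c := by
  have hterm : ∀ α ∈ (wordsOfType_finite k).toFinset,
      ((1 / weightProd μ α : ℝ) : ℂ) * starRingEnd ℂ (f α) =
        ((1 / weightProd μ α ^ 2 : ℝ) : ℂ) * starRingEnd ℂ c := fun α hα => by
    rw [hf α ((wordsOfType_finite k).mem_toFinset.1 hα), map_div₀, Complex.conj_ofReal]
    push_cast
    ring
  rw [symVector, inner_smul_right, inner_sum]
  simp only [inner_smul_right, inner_fockBasis]
  rw [Finset.sum_congr rfl hterm, ← Finset.sum_mul, ← Complex.ofReal_sum, ← symWeight, ← mul_assoc,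
    ← Complex.ofReal_mul, one_div_mul_cancel (hμ.symWeight_pos k).ne', Complex.ofReal_one, one_mul]

theorem inner_symVector_symVector (hμ : IsWeightSequence μ) (k l : Fin n → ℕ) :
    ⟪symVector μ l, symVector μ k⟫_ℂ = if k = l then 1 / (symWeight μ l : ℂ) else 0 := by
  rw [inner_symVector_of_forall_mem hμ fun α hα => symVector_apply_of_mem hα l]
  split_ifs <;> simp

theorem inner_symVector_multiShift (hμ : IsWeightSequence μ) (i : Fin n) (k l : Fin n → ℕ) :
    ⟪symVector μ l, multiShift μ hμ i (symVector μ k)⟫_ℂ =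
      ⟪symVector μ l, symVector μ (Pi.single i 1 + k)⟫_ℂ := by
  set c : ℂ := if Pi.single i 1 + k = l then 1 / (symWeight μ l : ℂ) else 0
  have hcoord : ∀ α ∈ wordsOfType k,
      (multiShift μ hμ i).adjoint (symVector μ l) α = c / weightProd μ α := fun α hα => by
    have hμα : (μ (FreeMonoid.of i * α) : ℂ) ≠ 0 := mod_cast (hμ.weight_of_mul_pos i α).ne'
    rw [adjoint_multiShift_apply, symVector_apply_of_mem (of_mul_mem_wordsOfType hα i),
      weightProd_of_mul, Complex.ofReal_mul, mul_div_assoc', mul_div_mul_left _ _ hμα]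
  rw [← ContinuousLinearMap.adjoint_inner_left, inner_symVector_of_forall_mem hμ hcoord,
    inner_symVector_of_forall_mem hμ fun α hα => symVector_apply_of_mem hα l]

variable (μ) in
/-- The vector `y^(k)` as an element of `F_s²(μ)`. -/
noncomputable def symBasis (k : Fin n → ℕ) : symFock μ :=
  ⟨symVector μ k, Submodule.le_topologicalClosure _ (Submodule.subset_span ⟨k, rfl⟩)⟩

theorem dense_span_symBasis :
    Dense (Submodule.span ℂ (Set.range (symBasis μ)) : Set (symFock μ)) := by
  have himage : (↑) '' (Submodule.span ℂ (Set.range (symBasis μ)) : Set (symFock μ)) =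
      (Submodule.span ℂ (Set.range (symVector μ)) : Set (FockSpace n)) := by
    rw [← Submodule.coe_subtype, ← Submodule.map_coe, Submodule.map_span, ← Set.range_comp]
    rfl
  exact Subtype.dense_iff.2 (himage ▸ subset_rfl)

theorem isOrthogonalBasis_symBasis (hμ : IsWeightSequence μ) :
    IsOrthogonalBasis ℂ (symBasis μ) where
  inner_eq_zero k l hkl := (inner_symVector_symVector hμ l k).trans (if_neg hkl.symm)
  ne_zero k hk := by
    have hzero : symVector μ k = 0 := congrArg Subtype.val hk
    have hinner := inner_symVector_symVector hμ k k
    rw [hzero, inner_zero_left, if_pos rfl] at hinner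
    exact one_div_ne_zero (Complex.ofReal_ne_zero.2 (hμ.symWeight_pos k).ne') hinner.symm
  dense_span := dense_span_symBasis

theorem isTranslation_symShift (hμ : IsWeightSequence μ) (i : Fin n) :
    IsTranslation (symBasis μ) (Pi.single i 1) (symShift μ hμ i) := fun k => by
  refine (isOrthogonalBasis_symBasis hμ).eq_of_forall_inner_eq fun l => ?_
  exact (Submodule.inner_orthogonalProjectionOnto_eq_of_mem_left (symBasis μ l) _).trans
    (inner_symVector_multiShift hμ i k l)

end SymmetricFock

theorem memℓp_two_of_norm_sum_le {α 𝕜 : Type*} [RCLike 𝕜] {f : α → 𝕜} {C : ℝ}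
    (h : ∀ (s : Finset α) (a : α → 𝕜), ‖∑ i ∈ s, a i * f i‖ ≤ C * √(∑ i ∈ s, ‖a i‖ ^ 2)) :
    Memℓp f 2 := by
  refine memℓp_gen' (C := C ^ 2) fun s => ?_
  set S := ∑ i ∈ s, ‖f i‖ ^ 2 with hS
  have hS0 : 0 ≤ S := Finset.sum_nonneg fun i _ => sq_nonneg _
  have hsum : ∑ i ∈ s, starRingEnd 𝕜 (f i) * f i = (S : 𝕜) := by
    simp only [RCLike.conj_mul, hS, RCLike.ofReal_sum, RCLike.ofReal_pow]
  have hle : S ≤ C * √S := by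
    simpa only [hsum, RCLike.norm_ofReal, abs_of_nonneg hS0, RCLike.norm_conj] using
      h s fun i => starRingEnd 𝕜 (f i)
  have hsq : S ≤ C ^ 2 := by nlinarith [Real.sq_sqrt hS0, sq_nonneg (C - √S)]
  simpa using hsq

section PointEvaluation

variable {n : ℕ} {μ : FreeMonoid (Fin n) → ℝ} {z : Fin n → ℂ}

theorem memℓp_pointEvaluation (hμ : IsWeightSequence μ) (hz : z ∈ pointEvaluations μ) :
    Memℓp (fun α => FreeMonoid.lift z α / (weightProd μ α : ℂ)) 2 := by
  obtain ⟨C, -, hC⟩ := hz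
  refine memℓp_two_of_norm_sum_le (C := C) fun s a => ?_
  have hnorm (α : FreeMonoid (Fin n)) :
      weightProd μ α ^ 2 * ‖a α / (weightProd μ α : ℂ)‖ ^ 2 = ‖a α‖ ^ 2 := by
    have hw := (hμ.weightProd_pos α).ne'
    rw [norm_div, Complex.norm_real, div_pow, Real.norm_eq_abs, sq_abs, mul_div_cancel₀]
    exact pow_ne_zero 2 hw
  have h := hC (Finsupp.indicator s fun α _ => a α / weightProd μ α)
  rw [Finsupp.sum_indicator_index _ (by simp), Finsupp.sum_indicator_index _ (by simp)] at h
  simpa only [hnorm, div_mul_eq_mul_div, mul_div_assoc] using h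

theorem exists_isPointEvaluation (hμ : IsWeightSequence μ) (hz : z ∈ pointEvaluations μ) :
    ∃ κ, IsPointEvaluation (symBasis μ) z κ := by
  let κ : FockSpace n := ⟨_, (memℓp_pointEvaluation hμ hz).star_mem⟩
  refine ⟨(symFock μ).orthogonalProjectionOnto κ, fun k => ?_⟩
  rw [Submodule.inner_orthogonalProjectionOnto_eq_of_mem_right]
  have hκ : ∀ α ∈ wordsOfType k, κ α = starRingEnd ℂ (∏ i, z i ^ k i) / weightProd μ α :=
    fun α hα => by
      change starRingEnd ℂ (FreeMonoid.lift z α / (weightProd μ α : ℂ)) = _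
      rw [map_div₀, Complex.conj_ofReal, hα z]
  exact (inner_symVector_of_forall_mem hμ hκ).trans (Complex.conj_conj _)

end PointEvaluation

end WeightedFock

theorem theorem6p4 (n : ℕ) (μ : FreeMonoid (Fin n) → ℝ)
    (hμ : WeightedFock.IsWeightSequence μ)
    (hD : WeightedFock.pointEvaluations μ ∈ 𝓝 (0 : Fin n → ℂ)) :
    WeightedFock.IsReflexive (WeightedFock.symHardyAlgebra μ hμ) := by
  refine WeightedFock.isReflexive_weakStarAdjoin (WeightedFock.isOrthogonalBasis_symBasis hμ)
    (WeightedFock.isTranslation_symShift hμ) ?_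
  filter_upwards [hD] with z hz using WeightedFock.exists_isPointEvaluation hμ hz
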